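/- Let $\mathbb D=\{z\in\mathbb C:|z|<1\}$ and $0\le\alpha<1$. Call a function $h$ on $\mathbb D$ a *factor* if it is analytic in $\mathbb D$ and $h(z)=\exp\left(\sum_{n\ge1}a_nz^n\right)$ for some power series convergent in $\mathbb D$. Let $\mathcal S^*_{Lh}(\alpha)$ be the class of functions $f$ on $\mathbb D$ such that: * $f(z)=zh_0(z)\overline{g_0(z)}$ for some factors $h_0,g_0$; * $f$ is univalent and sense-preserving ($|f_z|^2-|f_{\bar z}|^2>0$) in $\mathbb D$; * $f$ is log-harmonic, that is, it is a solution of $\overline{f_{\bar z}}/\overline{f}=\mu f_z/f$ (equivalently $\overline{f_{\bar z}}\,f=\mu f_z\overline{f}$) for some analytic $\mu:\mathbb D\to\mathbb D$ with $\mu(0)=0$; * $\operatorname{Re}\dfrac{zf_z(z)-\bar zf_{\bar z}(z)}{f(z)}>\alpha$ for all $z\in\mathbb D\setminus\{0\}$. Let $h,g:\mathbb D\to\mathbb C$ and $f(z)=zh(z)\overline{g(z)}$. Then $f\in\mathcal S^*_{Lh}(\alpha)$ with $h$ and $g$ factors if and only if there are two Borel probability measures $\delta$ and $\kappa$ on the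 unit circle $\partial\mathbb D$ such that, for all $z\in\mathbb D$, $$h(z)=\exp\left(\int_{\partial\mathbb D}\int_{\partial\mathbb D}K_1(z,\eta,\xi)\,d\delta(\eta)\,d\kappa(\xi)\right),\qquad g(z)=\exp\left(\int_{\partial\mathbb D}\int_{\partial\mathbb D}K_2(z,\eta,\xi)\,d\delta(\eta)\,d\kappa(\xi)\right),$$ where, with principal logarithms and $|\eta|=|\xi|=1$, $$K_1(z,\eta,\xi)=\begin{cases}\dfrac{(1-2\alpha)\eta+\xi}{\eta-\xi}\log\dfrac{1-\xi z}{1-\eta z}-\log(1-\eta z),&\eta\ne\xi,\\[2mm]\dfrac{2(1-\alpha)\eta z}{1-\eta z}-\log(1-\eta z),&\eta=\xi,\end{cases}$$ $$K_2(z,\eta,\xi)=\begin{cases}\dfrac{(1-2\alpha)\eta+\xi}{\eta-\xi}\log\dfrac{1-\xi z}{1-\eta z}+(1-2\alpha)\log(1-\eta z),&\eta\ne\xi,\\[2mm]\dfrac{2(1-\alpha)\eta z}{1-\eta z}+(1-2\alpha)\log(1-\eta z),&\eta=\xi.\end{cases}$$ -/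

import Mathlib

open MeasureTheory Metric

namespace LogHarmonic

/-- The open unit disk of the complex plane. -/
abbrev disk : Set ℂ := ball (0 : ℂ) 1

/-- The Wirtinger derivative `f_z = (f_x - i f_y) / 2`. -/
noncomputable def dz (f : ℂ → ℂ) (z : ℂ) : ℂ :=
  (fderiv ℝ f z 1 - Complex.I * fderiv ℝ f z Complex.I) / 2

/-- The Wirtinger derivative `f_{\bar z} = (f_x + i f_y) / 2`. -/
noncomputable def dzbar (f : ℂ → ℂ) (z : ℂ) : ℂ :=
  (fderiv ℝ f z 1 + Complex.I * fderiv ℝ f z Complex.I) / 2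

/-- The class of analytic functions on the unit disk with modulus less than one there. -/
def IsDilatation (μ : ℂ → ℂ) : Prop :=
  DifferentiableOn ℂ μ disk ∧ ∀ z ∈ disk, ‖μ z‖ < 1

/-- `f` is a solution in the unit disk of the equation
`conj (f_{\bar z}) / conj f = μ * (f_z / f)`, which is written without denominators because
`f` may have zeros. -/
def IsLogHarmonicWith (μ f : ℂ → ℂ) : Prop :=
  ContDiffOn ℝ 1 f disk ∧
    ∀ z ∈ disk, star (dzbar f z) * f z = μ z * dz f z * star (f z)

/-- `h` is analytic in the unit disk and `h(z) = exp (∑_{n ≥ 1} a_n z^n)` there. -/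
def IsFactor (h : ℂ → ℂ) : Prop :=
  DifferentiableOn ℂ h disk ∧
    ∃ a : ℕ → ℂ, ∀ z ∈ disk,
      ∃ s : ℂ, HasSum (fun n : ℕ => a (n + 1) * z ^ (n + 1)) s ∧ h z = Complex.exp s

/-- The class `S_Lh` of sense-preserving univalent log-harmonic mappings of the unit disk, with
second complex dilatation vanishing at the origin, of the form `f(z) = z h(z) conj (g(z))`, where
`h` and `g` are exponentials of power series without constant term. -/
structure IsSLh (f : ℂ → ℂ) : Prop where
  logHarmonic : ∃ μ : ℂ → ℂ, IsDilatation μ ∧ μ 0 = 0 ∧ IsLogHarmonicWith μ f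
  sensePreserving : ∀ z ∈ disk, 0 < ‖dz f z‖ ^ 2 - ‖dzbar f z‖ ^ 2
  univalent : Set.InjOn f disk
  factors : ∃ h g : ℂ → ℂ, IsFactor h ∧ IsFactor g ∧
    ∀ z ∈ disk, f z = z * h z * star (g z)

/-- The class `S*_Lh(α)` of log-harmonic starlike mappings of order `α`. -/
structure IsStarlike (α : ℝ) (f : ℂ → ℂ) : Prop where
  isSLh : IsSLh f
  starlike : ∀ z ∈ disk, z ≠ 0 → α < ((z * dz f z - star z * dzbar f z) / f z).re

open Classical in
/-- The kernel of the analytic factor; all logarithms are principal. -/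
noncomputable def K₁ (α : ℝ) (z : ℂ) (η ξ : sphere (0 : ℂ) 1) : ℂ :=
  if η = ξ then
    2 * (1 - α) * η * z / (1 - η * z) - Complex.log (1 - η * z)
  else
    ((1 - 2 * α) * η + ξ) / ((η : ℂ) - ξ) * Complex.log ((1 - ξ * z) / (1 - η * z))
      - Complex.log (1 - η * z)

open Classical in
/-- The kernel of the co-analytic factor; all logarithms are principal. -/
noncomputable def K₂ (α : ℝ) (z : ℂ) (η ξ : sphere (0 : ℂ) 1) : ℂ :=
  if η = ξ then
    2 * (1 - α) * η * z / (1 - η * z) + (1 - 2 * α) * Complex.log (1 - η * z)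
  else
    ((1 - 2 * α) * η + ξ) / ((η : ℂ) - ξ) * Complex.log ((1 - ξ * z) / (1 - η * z))
      + (1 - 2 * α) * Complex.log (1 - η * z)

end LogHarmonic

namespace LogHarmonic

open Filter Topology

/-! Write `h = exp S₁` and `g = exp S₂` with `S₁`, `S₂` analytic and zero at the origin. The
log-harmonic equation becomes `z S₂' = μ (1 + z S₁')`. Starlikeness becomes `Re P > α` for `P = 1 +
z S₁' - z S₂' = (1 - μ)(1 + z S₁')`, since conjugating `z S₂'` does not change the real part.

Let `T` denote the Cauchy transform of a probability measure on the circle. Herglotz's theorem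
(`exists_cauchyTransform_eq`) turns `Re P > α` into `P = 2(1 - α) T_δ - (1 - 2α)`, and `|μ| < 1`, `μ
0 = 0` into `T_κ = 1 / (1 - μ)`. Hence `1 + z S₁' = T_κ P` and `z S₂' = (T_κ - 1) P`. The kernels
`K₁`, `K₂` are the primitives in `z`, zero at the origin, of the corresponding products of Cauchy
kernels, so integrating them against `δ` and `κ` recovers `S₁` and `S₂`.

For the converse, `μ = 1 - 1 / T_κ` is a dilatation because `Re T_κ > 1/2`, and everything except
univalence is then computation. Univalence is `injOn_of_inward`: starlikeness makes the local
preimages of `exp (-t) f z` move towards the origin, so two points with the same image can both be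
pushed inward. -/

theorem hasDerivAt_integral_of_const_zero {X : Type*} [MeasurableSpace X] (ν : Measure X)
    [IsProbabilityMeasure ν] (Φ Φ' : ℂ → X → ℂ) (c : ℂ)
    (hm : ∀ z ∈ disk, AEStronglyMeasurable (Φ z) ν)
    (hm' : ∀ z ∈ disk, AEStronglyMeasurable (Φ' z) ν)
    (hd : ∀ z ∈ disk, ∀ x, HasDerivAt (fun w => Φ w x) (Φ' z x) z)
    (hb : ∀ r < 1, ∃ C, ∀ z, ‖z‖ ≤ r → ∀ x, ‖Φ' z x‖ ≤ C)
    (h0 : ∀ x, Φ 0 x = c) {z : ℂ} (hz : z ∈ disk) :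
    Integrable (Φ z) ν ∧ HasDerivAt (fun w => ∫ x, Φ w x ∂ν) (∫ x, Φ' z x ∂ν) z := by
  have hz1 : ‖z‖ < 1 := by simpa using hz
  obtain ⟨r, hzr, hr⟩ := exists_between hz1
  obtain ⟨C, hC⟩ := hb r hr
  have hsub : ∀ w, ‖w‖ ≤ r → w ∈ disk := fun w hw => by simpa using hw.trans_lt hr
  have hint : Integrable (Φ z) ν := by
    refine Integrable.mono' (integrable_const (C * ‖z‖ + ‖c‖)) (hm z hz) (Eventually.of_forall ?_)
    intro x
    -- The mean value inequality from the origin bounds `Φ z` uniformly, so integrability comes from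
    -- the derivative bound alone. For the kernels this avoids estimating the quotient by `η - ξ`.
    have := Convex.norm_image_sub_le_of_norm_hasDerivWithin_le (f := fun w => Φ w x)
      (f' := fun w => Φ' w x) (s := closedBall (0 : ℂ) r) (C := C) (x := 0) (y := z)
      (fun w hw => (hd w (hsub w (by simpa using hw)) x).hasDerivWithinAt)
      (fun w hw => hC w (by simpa using hw) x) (convex_closedBall _ _)
      (by simpa using (norm_nonneg z).trans hzr.le) (by simpa using hzr.le)
    rw [h0 x, sub_zero] at this
    calc ‖Φ z x‖ = ‖(Φ z x - c) + c‖ := by simp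
      _ ≤ _ := (norm_add_le _ _).trans (by gcongr)
  refine ⟨hint, ?_⟩
  have hnhds : ball (0 : ℂ) r ∈ 𝓝 z := isOpen_ball.mem_nhds (by simpa using hzr)
  refine (hasDerivAt_integral_of_dominated_loc_of_deriv_le (bound := fun _ => C) hnhds ?_ hint
    (hm' z hz) ?_ (integrable_const C) ?_).2
  · filter_upwards [hnhds] with w hw
    exact hm w (hsub w (by simpa using (mem_ball_zero_iff.1 hw).le))
  · exact Eventually.of_forall fun x w hw => hC w (mem_ball_zero_iff.1 hw).le x
  · exact Eventually.of_forall fun x w hw => hd w (hsub w (mem_ball_zero_iff.1 hw).le) x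

/-! ### Cauchy transforms of probability measures on the circle. -/

/-- The Cauchy transform of a measure on the unit circle. -/
noncomputable def cauchyTransform (δ : Measure (sphere (0 : ℂ) 1)) (z : ℂ) : ℂ :=
  ∫ η, (1 - (η : ℂ) * z)⁻¹ ∂δ

theorem norm_circle_mul (η : sphere (0 : ℂ) 1) (z : ℂ) : ‖(η : ℂ) * z‖ = ‖z‖ := by
  rw [norm_mul, mem_sphere_zero_iff_norm.1 η.2, one_mul]

theorem one_sub_norm_le (η : sphere (0 : ℂ) 1) (z : ℂ) : 1 - ‖z‖ ≤ ‖1 - (η : ℂ) * z‖ := by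
  have := norm_sub_norm_le (1 : ℂ) ((η : ℂ) * z)
  rwa [norm_one, norm_circle_mul] at this

theorem one_sub_circle_mul_ne_zero (η : sphere (0 : ℂ) 1) {z : ℂ} (hz : z ∈ disk) :
    1 - (η : ℂ) * z ≠ 0 := by
  have h1 : ‖z‖ < 1 := by simpa using hz
  have := one_sub_norm_le η z
  exact norm_pos_iff.1 (by linarith)

theorem norm_inv_one_sub_le (η : sphere (0 : ℂ) 1) {z : ℂ} {r : ℝ} (hr : r < 1) (hz : ‖z‖ ≤ r) :
    ‖(1 - (η : ℂ) * z)⁻¹‖ ≤ (1 - r)⁻¹ := by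
  rw [norm_inv]
  have := one_sub_norm_le η z
  exact inv_anti₀ (by linarith) (by linarith)

theorem hasDerivAt_inv_one_sub (η : ℂ) {z : ℂ} (h : 1 - η * z ≠ 0) :
    HasDerivAt (fun w => (1 - η * w)⁻¹) (η * (1 - η * z)⁻¹ ^ 2) z := by
  have h1 : HasDerivAt (fun w => 1 - η * w) (-η) z := by
    simpa using ((hasDerivAt_id z).const_mul η).const_sub 1
  convert! h1.fun_inv h using 1
  field_simp

theorem continuous_inv_one_sub {z : ℂ} (hz : z ∈ disk) :
    Continuous fun η : sphere (0 : ℂ) 1 => (1 - (η : ℂ) * z)⁻¹ :=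
  (by fun_prop : Continuous fun η : sphere (0 : ℂ) 1 => 1 - (η : ℂ) * z).inv₀
    fun η => one_sub_circle_mul_ne_zero η hz

section

variable (δ : Measure (sphere (0 : ℂ) 1)) [IsProbabilityMeasure δ]

theorem integrable_of_continuous {E : Type*} [NormedAddCommGroup E] {u : sphere (0 : ℂ) 1 → E}
    (hu : Continuous u) : Integrable u δ :=
  hu.integrable_of_hasCompactSupport (HasCompactSupport.of_compactSpace u)

theorem cauchyTransform_zero : cauchyTransform δ 0 = 1 := by simp [cauchyTransform]

theorem differentiableOn_cauchyTransform : DifferentiableOn ℂ (cauchyTransform δ) disk := by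
  intro z hz
  refine (hasDerivAt_integral_of_const_zero δ (fun z η => (1 - (η : ℂ) * z)⁻¹)
    (fun z η => (η : ℂ) * (1 - (η : ℂ) * z)⁻¹ ^ 2) 1
    (fun z hz => (continuous_inv_one_sub hz).aestronglyMeasurable)
    (fun z hz => (continuous_subtype_val.mul
      ((continuous_inv_one_sub hz).pow 2)).aestronglyMeasurable)
    (fun z hz η => hasDerivAt_inv_one_sub _ (one_sub_circle_mul_ne_zero η hz)) ?_ (by simp)
    hz).2.differentiableAt.differentiableWithinAt
  intro r hr
  refine ⟨(1 - r)⁻¹ ^ 2, fun z hz η => ?_⟩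
  rw [norm_circle_mul, norm_pow]
  gcongr
  exact norm_inv_one_sub_le η hr hz

theorem inv_le_re_inv_one_sub (η : sphere (0 : ℂ) 1) {z : ℂ} (hz : z ∈ disk) :
    (1 + ‖z‖)⁻¹ ≤ ((1 - (η : ℂ) * z)⁻¹).re := by
  have h1 : ‖z‖ < 1 := by simpa using hz
  have h2 := norm_circle_mul η z
  set w := (η : ℂ) * z
  have h0 : 1 - w ≠ 0 := one_sub_circle_mul_ne_zero η hz
  have h3 : 0 < Complex.normSq (1 - w) := Complex.normSq_pos.2 h0
  rw [Complex.inv_re, inv_eq_one_div, div_le_div_iff₀ (by positivity) h3]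
  have h4 : Complex.normSq (1 - w) = 1 - 2 * w.re + ‖w‖ ^ 2 := by
    rw [← Complex.normSq_eq_norm_sq, Complex.normSq_apply, Complex.normSq_apply]; simp; ring
  have h5 : -‖w‖ ≤ w.re := (abs_le.1 (Complex.abs_re_le_norm w)).1
  rw [h4]; simp only [Complex.sub_re, Complex.one_re]; rw [← h2] at h1 ⊢
  nlinarith [mul_nonneg (sub_nonneg.2 h1.le) (by linarith : 0 ≤ ‖w‖ + w.re)]

/-- The pointwise bound `(1 + ‖z‖)⁻¹` does not depend on `η` and exceeds `1/2`, so strictness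
survives integration. -/
theorem half_lt_re_cauchyTransform {z : ℂ} (hz : z ∈ disk) :
    1 / 2 < (cauchyTransform δ z).re := by
  have h1 : ‖z‖ < 1 := by simpa using hz
  have hi := integrable_of_continuous δ (continuous_inv_one_sub hz)
  have h2 : (cauchyTransform δ z).re = ∫ η, ((1 - (η : ℂ) * z)⁻¹).re ∂δ :=
    (integral_re hi).symm
  have h3 : ∫ _, (1 + ‖z‖)⁻¹ ∂δ ≤ ∫ η, ((1 - (η : ℂ) * z)⁻¹).re ∂δ :=
    integral_mono (integrable_const _) hi.re fun η => inv_le_re_inv_one_sub η hz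
  rw [integral_const, probReal_univ, one_smul] at h3
  rw [h2]
  refine lt_of_lt_of_le ?_ h3
  rw [inv_eq_one_div]
  exact one_div_lt_one_div_of_lt (by positivity) (by linarith)

end

/-! ### Herglotz representation. -/

/-- The point `exp (-iθ)` of the unit circle. -/
noncomputable def circlePoint (θ : ℝ) : sphere (0 : ℂ) 1 :=
  ⟨circleMap 0 1 (-θ), circleMap_mem_sphere 0 zero_le_one _⟩

theorem continuous_circlePoint : Continuous circlePoint :=
  ((continuous_circleMap 0 1).comp continuous_neg).subtype_mk _

theorem circlePoint_mul_circleMap (θ : ℝ) : (circlePoint θ : ℂ) * circleMap 0 1 θ = 1 := by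
  simp [circlePoint, circleMap, ← Complex.exp_add]

/-- The inverse point `η = 1 / ζ` turns `(ζ + w) / (ζ - w)` into `2 / (1 - η w) - 1`; this is why
`circlePoint` carries a minus sign. -/
theorem herglotzRieszKernel_circleMap (θ : ℝ) {w : ℂ} (hw : w ∈ disk) :
    herglotzRieszKernel 0 w (circleMap 0 1 θ) = 2 * (1 - (circlePoint θ : ℂ) * w)⁻¹ - 1 := by
  have h := circlePoint_mul_circleMap θ
  have h1 := one_sub_circle_mul_ne_zero (circlePoint θ) hw
  have h0 : circleMap 0 1 θ ≠ 0 := circleMap_ne_center one_ne_zero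
  have h2 : circleMap 0 1 θ - w ≠ 0 := by
    intro h3
    rw [sub_eq_zero] at h3
    rw [← h3, h] at h1
    simp at h1
  rw [herglotzRieszKernel_def, sub_zero, sub_zero]
  have h3 : (1 - (circlePoint θ : ℂ) * w) * (1 - (circlePoint θ : ℂ) * w)⁻¹ = 1 :=
    mul_inv_cancel₀ h1
  rw [div_eq_iff h2]
  linear_combination (-2 * w * (1 - (circlePoint θ : ℂ) * w)⁻¹) * h - 2 * circleMap 0 1 θ * h3

theorem exists_measure_of_continuous_nonneg (u : ℝ → ℝ) (hu : Continuous u) (h0 : ∀ θ, 0 ≤ u θ)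
    (h1 : (2 * Real.pi)⁻¹ * ∫ θ in 0..2 * Real.pi, u θ = 1) :
    ∃ ν : ProbabilityMeasure (sphere (0 : ℂ) 1), ∀ F : sphere (0 : ℂ) 1 → ℝ, Continuous F →
      ∫ η, F η ∂(ν : Measure (sphere (0 : ℂ) 1)) =
        (2 * Real.pi)⁻¹ * ∫ θ in 0..2 * Real.pi, F (circlePoint θ) * u θ := by
  have hpi := Real.pi_pos
  set d : ℝ → NNReal := fun θ => Real.toNNReal ((2 * Real.pi)⁻¹ * u θ) with hd
  have hdc : Continuous d := continuous_real_toNNReal.comp (by fun_prop)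
  have hdv : ∀ θ, (d θ : ℝ) = (2 * Real.pi)⁻¹ * u θ := fun θ =>
    Real.coe_toNNReal _ (mul_nonneg (by positivity) (h0 θ))
  set m : Measure ℝ :=
    (volume.restrict (Set.Ioc 0 (2 * Real.pi))).withDensity fun θ => (d θ : ENNReal) with hm
  set ν : Measure (sphere (0 : ℂ) 1) := m.map circlePoint with hν
  have key : ∀ F : sphere (0 : ℂ) 1 → ℝ, Continuous F →
      ∫ η, F η ∂ν = (2 * Real.pi)⁻¹ * ∫ θ in 0..2 * Real.pi, F (circlePoint θ) * u θ := by
    intro F hF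
    rw [hν, integral_map continuous_circlePoint.aemeasurable hF.aestronglyMeasurable, hm,
      integral_withDensity_eq_integral_smul hdc.measurable,
      intervalIntegral.integral_of_le (by positivity), ← integral_const_mul]
    refine integral_congr_ae (Eventually.of_forall fun θ => ?_)
    simp only [NNReal.smul_def, hdv, smul_eq_mul]
    ring
  have hprob : IsProbabilityMeasure ν := by
    have h2 := key (fun _ => 1) continuous_const
    simp only [one_mul, h1, integral_const, smul_eq_mul, mul_one] at h2
    constructor
    rwa [measureReal_def, ENNReal.toReal_eq_one_iff] at h2
  exact ⟨⟨ν, hprob⟩, key⟩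

/-- The dilations `p (r n * z)` extend to the closed disk and have a Poisson representation with a
positive density. A weak limit of these densities as `r n → 1` represents `Re p`. Two analytic
functions with equal real parts differ by a constant, fixed at the origin. -/
theorem exists_cauchyTransform_eq {p : ℂ → ℂ} (hp : DifferentiableOn ℂ p disk)
    (hre : ∀ z ∈ disk, 0 < (p z).re) (hp0 : p 0 = 1) :
    ∃ δ : Measure (sphere (0 : ℂ) 1), IsProbabilityMeasure δ ∧
      ∀ z ∈ disk, p z = 2 * cauchyTransform δ z - 1 := by
  obtain ⟨r, -, hr, hrlim⟩ := exists_seq_strictMono_tendsto' (zero_lt_one' ℝ)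
  have hmem : ∀ n, ∀ z : ℂ, ‖z‖ ≤ 1 → (r n : ℂ) * z ∈ disk := by
    intro n z hz
    rw [mem_ball_zero_iff, norm_mul, Complex.norm_real, Real.norm_of_nonneg (hr n).1.le]
    have := (hr n).2
    have := (hr n).1
    nlinarith
  have hpn : ∀ n, DiffContOnCl ℂ (fun z => p (r n * z)) (ball 0 1) := by
    intro n
    refine DifferentiableOn.diffContOnCl ?_
    rw [closure_ball _ one_ne_zero]
    exact hp.comp (by fun_prop) fun z hz => hmem n z (by simpa using hz)
  have hrep : ∀ n, ∀ w ∈ disk, (2 * Real.pi)⁻¹ * ∫ θ in 0..2 * Real.pi,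
      (2 * (1 - (circlePoint θ : ℂ) * w)⁻¹ - 1).re * (p (r n * circleMap 0 1 θ)).re =
        (p (r n * w)).re := by
    intro n w hw
    have h := congrArg Complex.re ((hpn n).circleAverage_re_herglotzRieszKernel_smul hw)
    rw [Real.circleAverage_def, Complex.smul_re, smul_eq_mul] at h
    rw [← h]
    congr 1
    have hcont : Continuous fun θ : ℝ =>
        ((2 * (1 - (circlePoint θ : ℂ) * w)⁻¹ - 1).re : ℂ) * p (r n * circleMap 0 1 θ) := by
      have h1 := (continuous_inv_one_sub hw).comp continuous_circlePoint
      have h2 : Continuous fun θ : ℝ => p (r n * circleMap 0 1 θ) :=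
        hp.continuousOn.comp_continuous (by fun_prop) fun θ => hmem n _ (by simp)
      exact (Complex.continuous_ofReal.comp (Complex.continuous_re.comp
        ((h1.const_mul 2).sub continuous_const))).mul h2
    have h3 := Complex.reCLM.intervalIntegral_comp_comm
      (hcont.intervalIntegrable (μ := volume) 0 (2 * Real.pi))
    simp only [Complex.reCLM_apply, Complex.re_ofReal_mul] at h3
    rw [h3]
    congr 1
    refine intervalIntegral.integral_congr fun θ _ => ?_
    simp only [Pi.smul_apply', Function.comp_apply, herglotzRieszKernel_circleMap θ hw,
      Complex.real_smul]
  have hu : ∀ n, Continuous fun θ : ℝ => (p (r n * circleMap 0 1 θ)).re := by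
    intro n
    refine Complex.continuous_re.comp ?_
    exact hp.continuousOn.comp_continuous (by fun_prop) fun θ => hmem n _ (by simp)
  -- Total mass one is the representation at `w = 0`.
  have hmeas := fun n => exists_measure_of_continuous_nonneg _ (hu n)
    (fun θ => (hre _ (hmem n _ (by simp))).le) (by
      have := hrep n 0 (by simp)
      norm_num [hp0] at this ⊢
      exact this)
  choose ν hν using hmeas
  -- Probability measures on the circle are weakly compact; a limit along an ultrafilter replaces
  -- the choice of a subsequence.
  obtain ⟨δ, -, hδ⟩ := isCompact_univ.ultrafilter_le_nhds ((hyperfilter ℕ).map ν) (by simp)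
  refine ⟨δ, inferInstance, ?_⟩
  have hlim : Tendsto ν (hyperfilter ℕ) (𝓝 δ) := hδ
  have hreal : ∀ w ∈ disk, (p w - (2 * cauchyTransform δ w - 1)).re = 0 := by
    intro w hw
    have hc : Continuous fun η : sphere (0 : ℂ) 1 => (2 * (1 - (η : ℂ) * w)⁻¹ - 1).re :=
      Complex.continuous_re.comp (by have := continuous_inv_one_sub hw; fun_prop)
    have h1 := (ProbabilityMeasure.tendsto_iff_forall_integral_tendsto.1 hlim)
      (BoundedContinuousFunction.mkOfCompact ⟨_, hc⟩)
    simp only [BoundedContinuousFunction.mkOfCompact_apply, ContinuousMap.coe_mk] at h1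
    simp only [hν _ _ hc, hrep _ w hw] at h1
    have h2 : Tendsto (fun n => (p (r n * w)).re) atTop (𝓝 (p w).re) := by
      have h5 : Tendsto (fun n => (r n : ℂ) * w) atTop (𝓝 w) := by
        simpa using ((Complex.continuous_ofReal.tendsto 1).comp hrlim).mul_const w
      exact (Complex.continuous_re.tendsto _).comp
        (((hp.continuousOn.continuousAt (isOpen_ball.mem_nhds hw)).tendsto).comp h5)
    have h3 := tendsto_nhds_unique h1 (h2.mono_left Nat.hyperfilter_le_atTop)
    have hi : Integrable (fun η : sphere (0 : ℂ) 1 => (1 - (η : ℂ) * w)⁻¹)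
      (δ : Measure (sphere (0 : ℂ) 1)) := integrable_of_continuous _ (continuous_inv_one_sub hw)
    have h4 : ∫ η : sphere (0 : ℂ) 1, (2 * (1 - (η : ℂ) * w)⁻¹ - 1).re
        ∂(δ : Measure (sphere (0 : ℂ) 1)) = (2 * cauchyTransform δ w - 1).re := by
      have h6 := integral_re ((hi.const_mul 2).sub (integrable_const 1))
      refine h6.trans ?_
      simp only [Pi.sub_apply]
      rw [integral_sub (hi.const_mul 2) (integrable_const 1), integral_const_mul]
      simp [cauchyTransform]
    rw [Complex.sub_re, ← h3, h4, sub_self]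
  have han : AnalyticOnNhd ℂ (fun w => p w - (2 * cauchyTransform δ w - 1)) disk :=
    (hp.sub (((differentiableOn_cauchyTransform δ).const_mul 2).sub_const 1)).analyticOnNhd
      isOpen_ball
  obtain ⟨c, hc⟩ := han.eq_const_of_re_eq_const hreal isOpen_ball
    ((convex_ball _ _).isConnected ⟨0, by simp⟩)
  have h0 := hc 0 (by simp)
  rw [hp0, cauchyTransform_zero] at h0
  intro z hz
  have := hc z hz
  rw [← h0] at this
  linear_combination this

/-! ### The kernels and their derivatives in `z`. -/

theorem re_one_sub_circle_mul_pos (η : sphere (0 : ℂ) 1) {z : ℂ} (hz : z ∈ disk) :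
    0 < (1 - (η : ℂ) * z).re := by
  have h1 : ‖z‖ < 1 := by simpa using hz
  have h2 := Complex.re_le_norm ((η : ℂ) * z)
  rw [norm_circle_mul] at h2
  simp only [Complex.sub_re, Complex.one_re]
  linarith

/-- If `a / b` were a real number `≤ 0`, then `a` would be a nonpositive multiple of `b`. This keeps
the principal logarithm in the kernels analytic. -/
theorem div_mem_slitPlane {a b : ℂ} (ha : 0 < a.re) (hb : 0 < b.re) :
    a / b ∈ Complex.slitPlane := by
  have hb0 : b ≠ 0 := fun h => by simp [h] at hb
  by_contra h
  rw [Complex.mem_slitPlane_iff, not_or, not_lt, not_not] at h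
  have h1 : a / b = ((a / b).re : ℂ) := Complex.ext (by simp) (by simp [h.2])
  rw [div_eq_iff hb0] at h1
  rw [h1, Complex.re_ofReal_mul] at ha
  nlinarith [h.1]

/-- The derivative of `K₂` with respect to the point of the disk. -/
noncomputable def derivK₂ (α : ℝ) (z : ℂ) (η ξ : sphere (0 : ℂ) 1) : ℂ :=
  ξ * (1 - (ξ : ℂ) * z)⁻¹ * (2 * (1 - α) * (1 - (η : ℂ) * z)⁻¹ - (1 - 2 * α))

/-- The derivative of `K₁` with respect to the point of the disk. -/
noncomputable def derivK₁ (α : ℝ) (z : ℂ) (η ξ : sphere (0 : ℂ) 1) : ℂ :=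
  derivK₂ α z η ξ + 2 * (1 - α) * (η * (1 - (η : ℂ) * z)⁻¹)

theorem K₁_eq (α : ℝ) (z : ℂ) (η ξ : sphere (0 : ℂ) 1) :
    K₁ α z η ξ = K₂ α z η ξ - 2 * (1 - α) * Complex.log (1 - η * z) := by
  unfold K₁ K₂
  split_ifs <;> ring

theorem hasDerivAt_log_one_sub (η : sphere (0 : ℂ) 1) {z : ℂ} (hz : z ∈ disk) :
    HasDerivAt (fun w => Complex.log (1 - (η : ℂ) * w)) (-(η * (1 - (η : ℂ) * z)⁻¹)) z := by
  have h1 : HasDerivAt (fun w => 1 - (η : ℂ) * w) (-(η : ℂ)) z := by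
    simpa using ((hasDerivAt_id z).const_mul (η : ℂ)).const_sub 1
  convert! h1.clog (Or.inl (re_one_sub_circle_mul_pos η hz)) using 1
  rw [div_eq_mul_inv, neg_mul]

/-- Differentiation cancels the denominator `η - ξ`, so the diagonal and off-diagonal branches share
one formula. -/
theorem hasDerivAt_K₂ (α : ℝ) (η ξ : sphere (0 : ℂ) 1) {z : ℂ} (hz : z ∈ disk) :
    HasDerivAt (fun w => K₂ α w η ξ) (derivK₂ α z η ξ) z := by
  have hη := one_sub_circle_mul_ne_zero η hz
  have hξ := one_sub_circle_mul_ne_zero ξ hz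
  have h1 : ∀ c : ℂ, HasDerivAt (fun w => 1 - c * w) (-c) z := fun c => by
    simpa using ((hasDerivAt_id z).const_mul c).const_sub 1
  have hl := (hasDerivAt_log_one_sub η hz).const_mul (1 - 2 * (α : ℂ))
  unfold K₂ derivK₂
  split_ifs with h
  · subst h
    have h2 : HasDerivAt (fun w => 2 * (1 - (α : ℂ)) * η * w) (2 * (1 - (α : ℂ)) * η) z := by
      simpa using (hasDerivAt_id z).const_mul (2 * (1 - (α : ℂ)) * η)
    convert! (h2.fun_div (h1 η) hη).fun_add hl using 1
    field_simp
    ring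
  · have hne : (η : ℂ) - ξ ≠ 0 := fun h2 => h (Subtype.ext (sub_eq_zero.1 h2))
    have h3 := ((h1 ξ).fun_div (h1 η) hη).clog
      (div_mem_slitPlane (re_one_sub_circle_mul_pos ξ hz) (re_one_sub_circle_mul_pos η hz))
    convert! (h3.const_mul (((1 - 2 * (α : ℂ)) * (η : ℂ) + ξ) / ((η : ℂ) - ξ))).fun_add hl using 1
    have hη' : 1 - z * (η : ℂ) ≠ 0 := by rwa [mul_comm]
    have hξ' : 1 - z * (ξ : ℂ) ≠ 0 := by rwa [mul_comm]
    field_simp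
    ring

theorem hasDerivAt_K₁ (α : ℝ) (η ξ : sphere (0 : ℂ) 1) {z : ℂ} (hz : z ∈ disk) :
    HasDerivAt (fun w => K₁ α w η ξ) (derivK₁ α z η ξ) z := by
  simp only [K₁_eq]
  convert! (hasDerivAt_K₂ α η ξ hz).fun_sub
    ((hasDerivAt_log_one_sub η hz).const_mul (2 * (1 - (α : ℂ)))) using 1
  rw [derivK₁]
  ring

theorem K₂_zero (α : ℝ) (η ξ : sphere (0 : ℂ) 1) : K₂ α 0 η ξ = 0 := by simp [K₂]

theorem K₁_zero (α : ℝ) (η ξ : sphere (0 : ℂ) 1) : K₁ α 0 η ξ = 0 := by simp [K₁]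

theorem measurable_K₂ (α : ℝ) (z : ℂ) :
    Measurable fun x : sphere (0 : ℂ) 1 × sphere (0 : ℂ) 1 => K₂ α z x.2 x.1 := by
  unfold K₂
  refine Measurable.ite (measurableSet_eq_fun measurable_snd measurable_fst) ?_ ?_ <;> fun_prop

theorem measurable_K₁ (α : ℝ) (z : ℂ) :
    Measurable fun x : sphere (0 : ℂ) 1 × sphere (0 : ℂ) 1 => K₁ α z x.2 x.1 := by
  simp only [K₁_eq]
  exact (measurable_K₂ α z).sub (by fun_prop)

theorem measurable_derivK₂ (α : ℝ) (z : ℂ) :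
    Measurable fun x : sphere (0 : ℂ) 1 × sphere (0 : ℂ) 1 => derivK₂ α z x.2 x.1 := by
  unfold derivK₂
  fun_prop

theorem measurable_derivK₁ (α : ℝ) (z : ℂ) :
    Measurable fun x : sphere (0 : ℂ) 1 × sphere (0 : ℂ) 1 => derivK₁ α z x.2 x.1 := by
  unfold derivK₁
  exact (measurable_derivK₂ α z).add (by fun_prop)

theorem norm_derivK₂_le (α : ℝ) {z : ℂ} {r : ℝ} (hr : r < 1) (hz : ‖z‖ ≤ r)
    (η ξ : sphere (0 : ℂ) 1) :
    ‖derivK₂ α z η ξ‖ ≤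
      (1 - r)⁻¹ * (‖2 * (1 - (α : ℂ))‖ * (1 - r)⁻¹ + ‖1 - 2 * (α : ℂ)‖) := by
  have h1 := norm_inv_one_sub_le η hr hz
  have h2 := norm_inv_one_sub_le ξ hr hz
  rw [derivK₂, norm_mul, norm_circle_mul]
  refine mul_le_mul h2 ((norm_sub_le _ _).trans ?_) (norm_nonneg _) ((norm_nonneg _).trans h2)
  rw [norm_mul]
  gcongr

theorem norm_derivK₁_le (α : ℝ) {z : ℂ} {r : ℝ} (hr : r < 1) (hz : ‖z‖ ≤ r)
    (η ξ : sphere (0 : ℂ) 1) :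
    ‖derivK₁ α z η ξ‖ ≤
      (1 - r)⁻¹ * (‖2 * (1 - (α : ℂ))‖ * (1 - r)⁻¹ + ‖1 - 2 * (α : ℂ)‖) +
        ‖2 * (1 - (α : ℂ))‖ * (1 - r)⁻¹ := by
  refine (norm_add_le _ _).trans (add_le_add (norm_derivK₂_le α hr hz η ξ) ?_)
  rw [norm_mul, norm_circle_mul]
  gcongr
  exact norm_inv_one_sub_le η hr hz

section

variable (α : ℝ) (δ κ : Measure (sphere (0 : ℂ) 1))

/-- The logarithm of the analytic factor. -/
noncomputable def logFactor₁ (z : ℂ) : ℂ := ∫ ξ, ∫ η, K₁ α z η ξ ∂δ ∂κ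

/-- The logarithm of the co-analytic factor. -/
noncomputable def logFactor₂ (z : ℂ) : ℂ := ∫ ξ, ∫ η, K₂ α z η ξ ∂δ ∂κ

theorem logFactor₁_zero : logFactor₁ α δ κ 0 = 0 := by simp [logFactor₁, K₁_zero]

theorem logFactor₂_zero : logFactor₂ α δ κ 0 = 0 := by simp [logFactor₂, K₂_zero]

variable [IsProbabilityMeasure δ] [IsProbabilityMeasure κ]

theorem hasDerivAt_logFactor₂ {z : ℂ} (hz : z ∈ disk) :
    HasDerivAt (logFactor₂ α δ κ) (∫ x, derivK₂ α z x.2 x.1 ∂κ.prod δ) z := by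
  have key := fun {z : ℂ} (hz : z ∈ disk) => hasDerivAt_integral_of_const_zero (κ.prod δ)
    (fun z x => K₂ α z x.2 x.1) (fun z x => derivK₂ α z x.2 x.1) 0
    (fun z _ => (measurable_K₂ α z).aestronglyMeasurable)
    (fun z _ => (measurable_derivK₂ α z).aestronglyMeasurable)
    (fun z hz x => hasDerivAt_K₂ α x.2 x.1 hz)
    (fun r hr => ⟨_, fun z hz x => norm_derivK₂_le α hr hz x.2 x.1⟩)
    (fun x => K₂_zero α x.2 x.1) hz
  refine (key hz).2.congr_of_eventuallyEq ?_
  filter_upwards [isOpen_ball.mem_nhds hz] with w hw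
  exact (integral_prod _ (key hw).1).symm

theorem hasDerivAt_logFactor₁ {z : ℂ} (hz : z ∈ disk) :
    HasDerivAt (logFactor₁ α δ κ) (∫ x, derivK₁ α z x.2 x.1 ∂κ.prod δ) z := by
  have key := fun {z : ℂ} (hz : z ∈ disk) => hasDerivAt_integral_of_const_zero (κ.prod δ)
    (fun z x => K₁ α z x.2 x.1) (fun z x => derivK₁ α z x.2 x.1) 0
    (fun z _ => (measurable_K₁ α z).aestronglyMeasurable)
    (fun z _ => (measurable_derivK₁ α z).aestronglyMeasurable)
    (fun z hz x => hasDerivAt_K₁ α x.2 x.1 hz)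
    (fun r hr => ⟨_, fun z hz x => norm_derivK₁_le α hr hz x.2 x.1⟩)
    (fun x => K₁_zero α x.2 x.1) hz
  refine (key hz).2.congr_of_eventuallyEq ?_
  filter_upwards [isOpen_ball.mem_nhds hz] with w hw
  exact (integral_prod _ (key hw).1).symm

theorem mul_inv_one_sub (η : sphere (0 : ℂ) 1) {z : ℂ} (hz : z ∈ disk) :
    z * (η * (1 - (η : ℂ) * z)⁻¹) = (1 - (η : ℂ) * z)⁻¹ - 1 := by
  linear_combination -(mul_inv_cancel₀ (one_sub_circle_mul_ne_zero η hz))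

theorem integral_sub_const (c d : ℂ) {z : ℂ} (hz : z ∈ disk) :
    ∫ η : sphere (0 : ℂ) 1, (c * (1 - (η : ℂ) * z)⁻¹ - d) ∂δ = c * cauchyTransform δ z - d := by
  rw [integral_sub ((integrable_of_continuous δ (continuous_inv_one_sub hz)).const_mul c)
    (integrable_const d), integral_const_mul]
  simp [cauchyTransform]

/-- `derivK₂` is a function of `ξ` times a function of `η`, so its integral over the product measure
factors. -/
theorem mul_integral_derivK₂ {z : ℂ} (hz : z ∈ disk) :
    z * ∫ x, derivK₂ α z x.2 x.1 ∂κ.prod δ =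
      (cauchyTransform κ z - 1) * (2 * (1 - α) * cauchyTransform δ z - (1 - 2 * α)) := by
  have h1 := integral_sub_const κ 1 1 hz
  rw [one_mul] at h1
  rw [← h1, ← integral_sub_const δ _ _ hz, ← integral_prod_mul, ← integral_const_mul]
  congr 1 with x
  rw [derivK₂, ← mul_assoc, mul_inv_one_sub _ hz, one_mul]

theorem mul_integral_derivK₁ {z : ℂ} (hz : z ∈ disk) :
    z * ∫ x, derivK₁ α z x.2 x.1 ∂κ.prod δ =
      cauchyTransform κ z * (2 * (1 - α) * cauchyTransform δ z - (1 - 2 * α)) - 1 := by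
  have hz1 : ‖z‖ < 1 := by simpa using hz
  have hi₂ : Integrable (fun x : sphere (0 : ℂ) 1 × sphere (0 : ℂ) 1 => derivK₂ α z x.2 x.1)
      (κ.prod δ) := .of_bound (measurable_derivK₂ α z).aestronglyMeasurable _
    (Eventually.of_forall fun x => norm_derivK₂_le α hz1 le_rfl x.2 x.1)
  have hc : Continuous fun η : sphere (0 : ℂ) 1 => 2 * (1 - (α : ℂ)) * (η * (1 - (η : ℂ) * z)⁻¹) :=
    continuous_const.mul (continuous_subtype_val.mul (continuous_inv_one_sub hz))
  have hi := (integrable_of_continuous δ hc).comp_snd κ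
  have h3 : z * ∫ η : sphere (0 : ℂ) 1, 2 * (1 - (α : ℂ)) * (η * (1 - (η : ℂ) * z)⁻¹) ∂δ =
      2 * (1 - α) * cauchyTransform δ z - 2 * (1 - α) := by
    rw [← integral_sub_const δ _ _ hz, ← integral_const_mul]
    congr 1 with η
    rw [mul_left_comm, mul_inv_one_sub _ hz]
    ring
  simp only [derivK₁]
  rw [integral_add hi₂ hi, mul_add, mul_integral_derivK₂ α δ κ hz, integral_fun_snd
    (f := fun η : sphere (0 : ℂ) 1 => 2 * (1 - (α : ℂ)) * (η * (1 - (η : ℂ) * z)⁻¹)),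
    probReal_univ, one_smul, h3]
  ring

end

/-! ### A univalence criterion. -/

/-- A local diffeomorphism of the disk vanishing only at the origin is injective as soon as the
preimages of the points `exp (-t) * f z` move towards the origin. -/
theorem injOn_of_inward {f : ℂ → ℂ} (L : ℂ → ℂ →L[ℝ] ℂ)
    (hL : ∀ z ∈ disk, HasStrictFDerivAt f (L z) z) (hinj : ∀ z ∈ disk, ∀ v, L z v = 0 → v = 0)
    (hf0 : f 0 = 0) (h0 : ∀ z ∈ disk, f z = 0 → z = 0)
    (hin : ∀ z ∈ disk, z ≠ 0 → ∀ v, L z v = -f z → inner ℝ z v < 0) :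
    Set.InjOn f disk := by
  have hequiv : ∀ z, ∃ e : ℂ ≃L[ℝ] ℂ, z ∈ disk → (e : ℂ →L[ℝ] ℂ) = L z := by
    intro z
    by_cases hz : z ∈ disk
    · refine ⟨(LinearEquiv.ofInjectiveEndo (L z : ℂ →ₗ[ℝ] ℂ)
        ((injective_iff_map_eq_zero _).2 (hinj z hz))).toContinuousLinearEquiv, fun _ => ?_⟩
      ext
      rfl
    · exact ⟨.refl ℝ ℂ, fun h => absurd h hz⟩
  choose f' hf' using hequiv
  have hf : ∀ z ∈ disk, HasStrictFDerivAt f (f' z : ℂ →L[ℝ] ℂ) z := fun z hz => by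
    rw [hf' z hz]; exact hL z hz
  replace hin : ∀ z ∈ disk, z ≠ 0 → inner ℝ z ((f' z).symm (-f z)) < 0 := fun z hz hz0 =>
    hin z hz hz0 _ (by rw [← hf' z hz]; simp)
  have hcont : ContinuousOn f disk := fun z hz => (hf z hz).continuousAt.continuousWithinAt
  have hmove : ∀ z ∈ disk, z ≠ 0 → ∃ F : ℝ → ℂ, Tendsto F (𝓝[>] 0) (𝓝 z) ∧
      ∀ᶠ t in 𝓝[>] (0 : ℝ), f (F t) = Real.exp (-t) • f z ∧ ‖F t‖ ^ 2 < ‖z‖ ^ 2 := by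
    intro z hz hz0
    set G := (hf z hz).localInverse f (f' z) z
    have hG : HasStrictFDerivAt G ((f' z).symm : ℂ →L[ℝ] ℂ) (f z) := (hf z hz).to_localInverse
    have hGz : G (f z) = z := (hf z hz).localInverse_apply_image
    have hpath : HasDerivAt (fun t : ℝ => Real.exp (-t) • f z) (-f z) 0 := by
      simpa using ((hasDerivAt_id (0 : ℝ)).neg.exp).smul_const (f z)
    have hp0 : Real.exp (-0) • f z = f z := by simp
    have hF : HasDerivAt (fun t : ℝ => G (Real.exp (-t) • f z)) ((f' z).symm (-f z)) 0 := by
      have := HasFDerivAt.comp_hasDerivAt (0 : ℝ) (by rw [hp0]; exact hG.hasFDerivAt) hpath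
      exact this
    have hlim : Tendsto (fun t : ℝ => Real.exp (-t) • f z) (𝓝[>] 0) (𝓝 (f z)) := by
      have := hpath.continuousAt.tendsto
      rw [hp0] at this
      exact this.mono_left nhdsWithin_le_nhds
    refine ⟨fun t => G (Real.exp (-t) • f z), ?_, ?_⟩
    · have := hF.continuousAt.tendsto
      rw [hp0, hGz] at this
      exact this.mono_left nhdsWithin_le_nhds
    · have hn : HasDerivAt (fun t : ℝ => ‖G (Real.exp (-t) • f z)‖ ^ 2)
          (2 * inner ℝ z ((f' z).symm (-f z))) 0 := by
        have := hF.norm_sq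
        rwa [hp0, hGz] at this
      -- The squared norm has negative derivative at `t = 0`, hence is strictly smaller for small `t
      -- > 0`.
      have hlt := (hn.hasDerivWithinAt (s := Set.Ioi 0)).limsup_slope_le'
        (by simp) (r := 0) (by linarith [hin z hz hz0])
      filter_upwards [hlim.eventually (hf z hz).eventually_right_inverse, hlt,
        self_mem_nhdsWithin] with t h1 h2 h3
      refine ⟨h1, ?_⟩
      rw [slope_def_field, hp0, hGz, sub_zero, div_lt_iff₀ h3] at h2
      linarith
  intro a ha b hb hab
  by_contra hne
  obtain ⟨r, hr, hr1⟩ := exists_between (max_lt (mem_ball_zero_iff.1 ha) (mem_ball_zero_iff.1 hb))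
  set B := closedBall (0 : ℂ) r
  have hB : B ⊆ disk := closedBall_subset_ball hr1
  set S : Set (ℂ × ℂ) := {x ∈ B ×ˢ B | f x.1 = f x.2 ∧ x.1 ≠ x.2}
  -- The condition `x.1 ≠ x.2` is not closed in itself, but pairs in `S` cannot converge to the
  -- diagonal because `f` is locally injective.
  have hS : IsCompact S := by
    refine ((isCompact_closedBall _ _).prod (isCompact_closedBall _ _)).of_isClosed_subset ?_
      fun x hx => hx.1
    refine isClosed_of_closure_subset fun x hx => ?_
    have hxB : x ∈ B ×ˢ B :=
      (isClosed_closedBall.prod isClosed_closedBall).closure_subset_iff.2 (fun x hx => hx.1) hx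
    have hx1 := hB hxB.1
    have hx2 := hB hxB.2
    obtain ⟨u, hu, hux⟩ := mem_closure_iff_seq_limit.1 hx
    have ht1 := (continuous_fst.tendsto x).comp hux
    have ht2 := (continuous_snd.tendsto x).comp hux
    have h1 := ((hf _ hx1).continuousAt.tendsto).comp ht1
    have h2 := ((hf _ hx2).continuousAt.tendsto).comp ht2
    refine ⟨hxB, tendsto_nhds_unique h1 (h2.congr fun n => (hu n).2.1.symm), fun heq => ?_⟩
    have hl := (hf _ hx1).eventually_left_inverse
    have hl1 := ht1.eventually hl
    rw [← heq] at ht2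
    have hl2 := ht2.eventually hl
    obtain ⟨n, hn1, hn2⟩ := (hl1.and hl2).exists
    refine (hu n).2.2 ?_
    simp only [Function.comp_apply] at hn1 hn2
    rw [← hn1, ← hn2, (hu n).2.1]
  have hne : S.Nonempty := ⟨(a, b), ⟨⟨by simpa [B] using ((le_max_left _ _).trans_lt hr).le,
    by simpa [B] using ((le_max_right _ _).trans_lt hr).le⟩, hab, hne⟩⟩
  -- Moving both points of a minimal pair along the preimages of `exp (-t) • f x = exp (-t) • f y`
  -- gives a smaller pair in `S`, a contradiction.
  obtain ⟨⟨x, y⟩, hxy, hmin⟩ := hS.exists_isMinOn hne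
    (f := fun x => ‖x.1‖ ^ 2 + ‖x.2‖ ^ 2) (by fun_prop)
  obtain ⟨⟨hx, hy⟩, hfxy, hxyne⟩ := hxy
  simp only at hx hy hfxy hxyne
  have hx0 : x ≠ 0 := fun h =>
    hxyne (h.trans (h0 y (hB hy) (by rw [← hfxy, h, hf0])).symm)
  have hy0 : y ≠ 0 := fun h =>
    hxyne ((h0 x (hB hx) (by rw [hfxy, h, hf0])).trans h.symm)
  obtain ⟨F, hF, hF'⟩ := hmove x (hB hx) hx0
  obtain ⟨G, hG, hG'⟩ := hmove y (hB hy) hy0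
  have hFG : ∀ᶠ t in 𝓝[>] (0 : ℝ), F t ≠ G t :=
    ((hF.sub hG).eventually_ne (sub_ne_zero.2 hxyne)).mono fun t h => sub_ne_zero.1 h
  obtain ⟨t, ⟨h1, h2⟩, ⟨h3, h4⟩, h5⟩ := (hF'.and (hG'.and hFG)).exists
  have h6 : (F t, G t) ∈ S := by
    refine ⟨⟨?_, ?_⟩, by simp only [h1, h3, hfxy], h5⟩
    · simp only [B, mem_closedBall_zero_iff] at hx ⊢
      exact (lt_of_pow_lt_pow_left₀ 2 (norm_nonneg _) h2).le.trans hx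
    · simp only [B, mem_closedBall_zero_iff] at hy ⊢
      exact (lt_of_pow_lt_pow_left₀ 2 (norm_nonneg _) h4).le.trans hy
  have h7 : ‖x‖ ^ 2 + ‖y‖ ^ 2 ≤ ‖F t‖ ^ 2 + ‖G t‖ ^ 2 := hmin h6
  linarith

/-! ### Analytic logarithms of the factors. -/

theorem eqOn_disk_of_mul_deriv_eq {F G : ℂ → ℂ} (hF : DifferentiableOn ℂ F disk)
    (hG : DifferentiableOn ℂ G disk) (h0 : F 0 = G 0)
    (h : ∀ z ∈ disk, z * deriv F z = z * deriv G z) : Set.EqOn F G disk := by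
  have h0d : (0 : ℂ) ∈ disk := by simp
  have hne : ∀ z ∈ disk, z ≠ 0 → deriv F z = deriv G z := fun z hz hz0 =>
    mul_left_cancel₀ hz0 (h z hz)
  refine isOpen_ball.eqOn_of_deriv_eq (convex_ball _ _).isPreconnected hF hG (fun z hz => ?_)
    h0d h0
  rcases eq_or_ne z 0 with rfl | hz0
  -- The factor `z` hides the derivatives at the origin; continuity recovers their equality.
  · have hd := isOpen_ball.mem_nhds h0d
    have h1 := ((hF.deriv isOpen_ball).continuousOn.continuousAt hd).tendsto
    have h2 := ((hG.deriv isOpen_ball).continuousOn.continuousAt hd).tendsto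
    refine tendsto_nhds_unique (h1.mono_left (nhdsWithin_le_nhds (s := {0}ᶜ)))
      ((h2.mono_left (nhdsWithin_le_nhds (s := {0}ᶜ))).congr' ?_)
    filter_upwards [nhdsWithin_le_nhds hd, self_mem_nhdsWithin] with w hw hw0
    exact (hne w hw hw0).symm
  · exact hne z hz hz0

theorem isFactor_iff {h : ℂ → ℂ} :
    IsFactor h ↔ ∃ S : ℂ → ℂ, DifferentiableOn ℂ S disk ∧ S 0 = 0 ∧
      ∀ z ∈ disk, h z = Complex.exp (S z) := by
  constructor
  · rintro ⟨-, a, ha⟩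
    refine ⟨fun z => ∑' n : ℕ, a (n + 1) * z ^ (n + 1), ?_, by simp, fun z hz => ?_⟩
    · intro z hz
      obtain ⟨ρ, hzρ, hρ⟩ := exists_between (mem_ball_zero_iff.1 hz)
      have hρ0 : 0 ≤ ρ := (norm_nonneg z).trans hzρ.le
      -- Summability at the real point `ρ > ‖z‖` is absolute and dominates the series on the ball of
      -- radius `ρ`.
      obtain ⟨s, hs, -⟩ := ha ρ (by simpa [abs_of_nonneg hρ0] using hρ)
      refine ((Complex.differentiableOn_tsum_of_summable_norm hs.summable.norm
        (fun n => by fun_prop) (isOpen_ball (x := (0 : ℂ)) (ε := ρ)) ?_).differentiableAt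
        (isOpen_ball.mem_nhds (by simpa using hzρ))).differentiableWithinAt
      intro n w hw
      rw [norm_mul, norm_mul, norm_pow, norm_pow, Complex.norm_real, Real.norm_of_nonneg hρ0]
      gcongr
      exact (mem_ball_zero_iff.1 hw).le
    · obtain ⟨s, hs, hh⟩ := ha z hz
      exact hh.trans (congrArg _ hs.tsum_eq.symm)
  · rintro ⟨S, hS, hS0, hh⟩
    refine ⟨(Complex.differentiable_exp.comp_differentiableOn hS).congr hh,
      fun n => (n.factorial : ℂ)⁻¹ * iteratedDeriv n S 0, fun z hz => ⟨S z, ?_, hh z hz⟩⟩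
    have h1 := Complex.hasSum_taylorSeries_on_ball hS hz
    rw [← hasSum_nat_add_iff' 1] at h1
    simp only [Finset.sum_range_one, sub_zero, pow_zero, iteratedDeriv_zero, hS0, smul_eq_mul,
      mul_zero] at h1
    convert! h1 using 2
    ring

/-! ### Wirtinger calculus and the class conditions in terms of `S₁`, `S₂`. -/

/-- The real linear map with Wirtinger derivatives `a` and `b`. -/
noncomputable def wirtinger (a b : ℂ) : ℂ →L[ℝ] ℂ :=
  a • ContinuousLinearMap.id ℝ ℂ + b • (Complex.conjCLE : ℂ →L[ℝ] ℂ)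

theorem wirtinger_apply (a b v : ℂ) : wirtinger a b v = a * v + b * star v := by
  simp [wirtinger]

theorem dz_eq {f : ℂ → ℂ} {z a b : ℂ} (h : HasFDerivAt f (wirtinger a b) z) : dz f z = a := by
  rw [dz, h.fderiv, wirtinger_apply, wirtinger_apply]
  simp only [star_one, Complex.star_def, Complex.conj_I]
  linear_combination (-a / 2 + b / 2) * Complex.I_mul_I

theorem dzbar_eq {f : ℂ → ℂ} {z a b : ℂ} (h : HasFDerivAt f (wirtinger a b) z) :
    dzbar f z = b := by
  rw [dzbar, h.fderiv, wirtinger_apply, wirtinger_apply]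
  simp only [star_one, Complex.star_def, Complex.conj_I]
  linear_combination (a / 2 - b / 2) * Complex.I_mul_I

theorem hasStrictFDerivAt_mul_star {F G : ℂ → ℂ} {a b z : ℂ} (hF : HasStrictDerivAt F a z)
    (hG : HasStrictDerivAt G b z) :
    HasStrictFDerivAt (fun w => F w * star (G w))
      (wirtinger (a * star (G z)) (F z * star b)) z := by
  convert! hF.complexToReal_fderiv.fun_mul' hG.complexToReal_fderiv.star using 1
  ext
  simp [wirtinger_apply]
  ring

theorem hasStrictFDerivAt_exp_mul_star {f S₁ S₂ : ℂ → ℂ} (hS₁ : DifferentiableOn ℂ S₁ disk)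
    (hS₂ : DifferentiableOn ℂ S₂ disk)
    (hf : ∀ z ∈ disk, f z = z * Complex.exp (S₁ z) * star (Complex.exp (S₂ z)))
    {z : ℂ} (hz : z ∈ disk) :
    HasStrictFDerivAt f (wirtinger
      (Complex.exp (S₁ z) * (1 + z * deriv S₁ z) * star (Complex.exp (S₂ z)))
      (z * Complex.exp (S₁ z) * star (Complex.exp (S₂ z) * deriv S₂ z))) z := by
  have hd := isOpen_ball.mem_nhds hz
  have h1 := (hS₁.analyticAt hd).hasStrictDerivAt.cexp
  have h2 := (hS₂.analyticAt hd).hasStrictDerivAt.cexp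
  have h3 := hasStrictFDerivAt_mul_star ((hasStrictDerivAt_id z).fun_mul h1) h2
  refine HasStrictFDerivAt.congr_of_eventuallyEq (f := fun w =>
    id w * Complex.exp (S₁ w) * star (Complex.exp (S₂ w))) ?_ ?_
  · convert! h3 using 2
    simp only [id]
    ring
  · filter_upwards [hd] with w hw
    exact (hf w hw).symm

/-- With `t = a u`, the imaginary part of the hypothesis says that `t (1 - μ)` is real, and the real
part determines it. For the differential of `f`, `c = 0` yields injectivity and `c = 1` the inward
direction. -/
theorem exists_real_of_add_star {a μ u : ℂ} {c : ℝ} (h : a * u + star (μ * a * u) = -c) :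
    ∃ s : ℝ, a * (1 - μ) * u = s ∧ s * (1 - ‖μ‖ ^ 2) = -c * ‖1 - μ‖ ^ 2 := by
  have hre := congrArg Complex.re h
  have him := congrArg Complex.im h
  simp only [Complex.add_re, Complex.add_im, Complex.star_def, Complex.conj_re, Complex.conj_im,
    Complex.neg_re, Complex.neg_im, Complex.ofReal_re, Complex.ofReal_im] at hre him
  set t := a * u
  have ht : μ * a * u = μ * t := by ring
  rw [ht] at hre him
  have hs : (t * (1 - μ)).im = 0 := by
    rw [mul_sub, mul_one, mul_comm t μ, Complex.sub_im]
    linarith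
  refine ⟨(t * (1 - μ)).re, ?_, ?_⟩
  · rw [show a * (1 - μ) * u = t * (1 - μ) by ring]
    exact Complex.ext (by simp) (by simp only [hs, Complex.ofReal_im])
  · rw [← Complex.normSq_eq_norm_sq, ← Complex.normSq_eq_norm_sq, Complex.normSq_apply,
      Complex.normSq_apply]
    simp only [Complex.mul_re, Complex.mul_im, Complex.sub_re, Complex.sub_im, Complex.one_re,
      Complex.one_im] at hre him hs ⊢
    linear_combination 2 * μ.im * hs + ((1 - μ.re) ^ 2 + μ.im ^ 2) * hre

theorem isStarlike_of_exp {α : ℝ} (hα : 0 ≤ α) {f S₁ S₂ μ : ℂ → ℂ}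
    (hS₁ : DifferentiableOn ℂ S₁ disk) (hS₂ : DifferentiableOn ℂ S₂ disk)
    (hS₁0 : S₁ 0 = 0) (hS₂0 : S₂ 0 = 0) (hμ : IsDilatation μ) (hμ0 : μ 0 = 0)
    (hB : ∀ z ∈ disk, z * deriv S₂ z = μ z * (1 + z * deriv S₁ z))
    (hP : ∀ z ∈ disk, α < (1 + z * deriv S₁ z - z * deriv S₂ z).re)
    (hf : ∀ z ∈ disk, f z = z * Complex.exp (S₁ z) * star (Complex.exp (S₂ z))) :
    IsStarlike α f := by
  have hL := fun z (hz : z ∈ disk) => hasStrictFDerivAt_exp_mul_star hS₁ hS₂ hf hz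
  have hdz := fun z (hz : z ∈ disk) => dz_eq (hL z hz).hasFDerivAt
  have hdzbar := fun z (hz : z ∈ disk) => dzbar_eq (hL z hz).hasFDerivAt
  have hPre : ∀ z ∈ disk, 0 < ((1 + z * deriv S₁ z) * (1 - μ z)).re := fun z hz => by
    have := hP z hz
    rw [hB z hz] at this
    rw [show (1 + z * deriv S₁ z) * (1 - μ z) =
      1 + z * deriv S₁ z - μ z * (1 + z * deriv S₁ z) by ring]
    linarith
  have hf0 : ∀ z ∈ disk, f z = 0 → z = 0 := fun z hz h => by
    rw [hf z hz] at h
    simpa using h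
  -- Dividing the equation by `f z` and setting `u = v / z` gives the form of
  -- `exists_real_of_add_star`.
  have hsol : ∀ z ∈ disk, z ≠ 0 → ∀ c : ℝ, ∀ v, wirtinger
      (Complex.exp (S₁ z) * (1 + z * deriv S₁ z) * star (Complex.exp (S₂ z)))
      (z * Complex.exp (S₁ z) * star (Complex.exp (S₂ z) * deriv S₂ z)) v = -c * f z →
      ∃ s : ℝ, (1 + z * deriv S₁ z) * (1 - μ z) * (v / z) = s ∧
        s * (1 - ‖μ z‖ ^ 2) = -c * ‖1 - μ z‖ ^ 2 := by
    intro z hz hz0 c v hv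
    refine exists_real_of_add_star ?_
    have hfz : f z ≠ 0 := fun h => hz0 (hf0 z hz h)
    refine mul_right_cancel₀ hfz (Eq.trans ?_ hv)
    have h2 : star v = star (v / z) * star z := by rw [← star_mul', div_mul_cancel₀ _ hz0]
    rw [wirtinger_apply, hf z hz, ← hB z hz, h2]
    simp only [star_mul']
    field_simp
  refine ⟨⟨⟨μ, hμ, hμ0, ?_, ?_⟩, ?_, ?_, ?_⟩, ?_⟩
  · have he : ∀ S : ℂ → ℂ, DifferentiableOn ℂ S disk →
        ContDiffOn ℝ 1 (fun z => Complex.exp (S z)) disk := fun S hS =>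
      ((Complex.differentiable_exp.comp_differentiableOn hS).contDiffOn
        isOpen_ball).restrict_scalars ℝ
    refine ContDiffOn.congr ?_ hf
    exact (contDiffOn_id.mul (he _ hS₁)).mul
      ((starL' ℝ : ℂ ≃L[ℝ] ℂ).contDiff.comp_contDiffOn (he _ hS₂))
  · intro z hz
    rw [hdz z hz, hdzbar z hz, hf z hz]
    simp only [star_mul', star_star]
    linear_combination (star z * star (Complex.exp (S₁ z)) * Complex.exp (S₂ z) *
      Complex.exp (S₁ z) * star (Complex.exp (S₂ z))) * hB z hz
  · intro z hz
    rw [hdz z hz, hdzbar z hz]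
    have h1 : ‖z * Complex.exp (S₁ z) * star (Complex.exp (S₂ z) * deriv S₂ z)‖ =
        ‖μ z‖ * ‖Complex.exp (S₁ z) * (1 + z * deriv S₁ z) * star (Complex.exp (S₂ z))‖ := by
      have := congrArg norm (hB z hz)
      simp only [norm_mul, norm_star] at this ⊢
      linear_combination (‖Complex.exp (S₁ z)‖ * ‖Complex.exp (S₂ z)‖) * this
    have h2 : 1 + z * deriv S₁ z ≠ 0 := fun h => by
      have := hPre z hz
      simp [h] at this
    have h3 : 0 < ‖Complex.exp (S₁ z) * (1 + z * deriv S₁ z) * star (Complex.exp (S₂ z))‖ :=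
      norm_pos_iff.2 (by simp [h2])
    have h4 := hμ.2 z hz
    rw [h1, sub_pos]
    refine pow_lt_pow_left₀ ?_ (by positivity) two_ne_zero
    exact mul_lt_of_lt_one_left h3 h4
  · refine injOn_of_inward _ hL ?_ (by simp [hf 0 (by simp)]) hf0 ?_
    · intro z hz v hv
      rcases eq_or_ne z 0 with rfl | hz0
      · simpa [wirtinger_apply, hS₁0, hS₂0] using hv
      · obtain ⟨s, hs, hs'⟩ := hsol z hz hz0 0 v (by simpa using hv)
        have h4 : 0 < 1 - ‖μ z‖ ^ 2 := by nlinarith [hμ.2 z hz, norm_nonneg (μ z)]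
        rw [neg_zero, zero_mul, mul_eq_zero, or_iff_left h4.ne'] at hs'
        have h5 : (1 + z * deriv S₁ z) * (1 - μ z) ≠ 0 := fun h => by
          have := hPre z hz
          simp [h] at this
        rw [hs', Complex.ofReal_zero, mul_eq_zero, or_iff_right h5, div_eq_zero_iff,
          or_iff_left hz0] at hs
        exact hs
    · intro z hz hz0 v hv
      obtain ⟨s, hs, hs'⟩ := hsol z hz hz0 1 v (by simpa using hv)
      have h4 : 0 < 1 - ‖μ z‖ ^ 2 := by nlinarith [hμ.2 z hz, norm_nonneg (μ z)]
      have h6 : 1 - μ z ≠ 0 := fun h => by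
        have := hPre z hz
        simp [h] at this
      have h7 : 0 < ‖1 - μ z‖ ^ 2 := by positivity
      have hs0 : s < 0 := by nlinarith
      have hp := hPre z hz
      set p := (1 + z * deriv S₁ z) * (1 - μ z)
      have hp0 : p ≠ 0 := fun h => by simp [h] at hp
      -- Here `s < 0` and `Re p > 0`, so `Re (v * star z) = s ‖z‖² Re (1 / p)` is negative.
      have hv' : v = s * p⁻¹ * z := by
        field_simp at hs ⊢
        linear_combination hs
      have h8 : v * star z = s * (p⁻¹ * (‖z‖ ^ 2 : ℝ)) := by
        rw [hv', Complex.ofReal_pow, ← Complex.conj_mul', Complex.star_def]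
        ring
      rw [Complex.inner, ← Complex.star_def, h8, Complex.re_ofReal_mul, Complex.re_mul_ofReal,
        Complex.inv_re]
      have h9 := Complex.normSq_pos.2 hp0
      have h10 : 0 < ‖z‖ ^ 2 := by positivity
      exact mul_neg_of_neg_of_pos hs0 (by positivity)
  · exact ⟨fun z => Complex.exp (S₁ z), fun z => Complex.exp (S₂ z),
      isFactor_iff.2 ⟨S₁, hS₁, hS₁0, fun _ _ => rfl⟩,
      isFactor_iff.2 ⟨S₂, hS₂, hS₂0, fun _ _ => rfl⟩, hf⟩
  · intro z hz hz0
    have h1 : (z * dz f z - star z * dzbar f z) / f z =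
        1 + z * deriv S₁ z - star (z * deriv S₂ z) := by
      rw [div_eq_iff fun h => hz0 (hf0 z hz h), hdz z hz, hdzbar z hz, hf z hz]
      simp only [star_mul']
      ring
    rw [h1]
    simpa using hP z hz

theorem exists_dilatation_of_isStarlike {α : ℝ} (hα : α < 1) {f S₁ S₂ : ℂ → ℂ}
    (hS₁ : DifferentiableOn ℂ S₁ disk) (hS₂ : DifferentiableOn ℂ S₂ disk)
    (hf : ∀ z ∈ disk, f z = z * Complex.exp (S₁ z) * star (Complex.exp (S₂ z)))
    (h : IsStarlike α f) :
    (∃ μ, IsDilatation μ ∧ μ 0 = 0 ∧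
      ∀ z ∈ disk, z * deriv S₂ z = μ z * (1 + z * deriv S₁ z)) ∧
    ∀ z ∈ disk, α < (1 + z * deriv S₁ z - z * deriv S₂ z).re := by
  have hL := fun z (hz : z ∈ disk) => hasStrictFDerivAt_exp_mul_star hS₁ hS₂ hf hz
  have hdz := fun z (hz : z ∈ disk) => dz_eq (hL z hz).hasFDerivAt
  have hdzbar := fun z (hz : z ∈ disk) => dzbar_eq (hL z hz).hasFDerivAt
  obtain ⟨⟨⟨μ, hμ, hμ0, -, hlh⟩, -, -, -⟩, hst⟩ := h
  refine ⟨⟨μ, hμ, hμ0, fun z hz => ?_⟩, fun z hz => ?_⟩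
  · rcases eq_or_ne z 0 with rfl | hz0
    · simp [hμ0]
    have h1 := hlh z hz
    rw [hdz z hz, hdzbar z hz, hf z hz] at h1
    simp only [star_mul', star_star] at h1
    have h2 : star z * star (Complex.exp (S₁ z)) * Complex.exp (S₂ z) *
      Complex.exp (S₁ z) * star (Complex.exp (S₂ z)) ≠ 0 := by simp [hz0]
    refine mul_left_cancel₀ h2 ?_
    linear_combination h1
  · rcases eq_or_ne z 0 with rfl | hz0
    · simpa using hα
    have h2 : f z ≠ 0 := by simp [hf z hz, hz0]
    have h1 : (z * dz f z - star z * dzbar f z) / f z =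
        1 + z * deriv S₁ z - star (z * deriv S₂ z) := by
      rw [div_eq_iff h2, hdz z hz, hdzbar z hz, hf z hz]
      simp only [star_mul']
      ring
    have h3 := hst z hz hz0
    rw [h1] at h3
    simpa using h3

/-! ### From measures to mappings and back. -/

theorem mul_deriv_logFactor₁ (α : ℝ) (δ κ : Measure (sphere (0 : ℂ) 1)) [IsProbabilityMeasure δ]
    [IsProbabilityMeasure κ] {z : ℂ} (hz : z ∈ disk) : z * deriv (logFactor₁ α δ κ) z =
      cauchyTransform κ z * (2 * (1 - α) * cauchyTransform δ z - (1 - 2 * α)) - 1 := by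
  rw [(hasDerivAt_logFactor₁ α δ κ hz).deriv, mul_integral_derivK₁ α δ κ hz]

theorem mul_deriv_logFactor₂ (α : ℝ) (δ κ : Measure (sphere (0 : ℂ) 1)) [IsProbabilityMeasure δ]
    [IsProbabilityMeasure κ] {z : ℂ} (hz : z ∈ disk) : z * deriv (logFactor₂ α δ κ) z =
      (cauchyTransform κ z - 1) * (2 * (1 - α) * cauchyTransform δ z - (1 - 2 * α)) := by
  rw [(hasDerivAt_logFactor₂ α δ κ hz).deriv, mul_integral_derivK₂ α δ κ hz]

theorem differentiableOn_logFactor₁ (α : ℝ) (δ κ : Measure (sphere (0 : ℂ) 1))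
    [IsProbabilityMeasure δ] [IsProbabilityMeasure κ] :
    DifferentiableOn ℂ (logFactor₁ α δ κ) disk := fun _ hz =>
  (hasDerivAt_logFactor₁ α δ κ hz).differentiableAt.differentiableWithinAt

theorem differentiableOn_logFactor₂ (α : ℝ) (δ κ : Measure (sphere (0 : ℂ) 1))
    [IsProbabilityMeasure δ] [IsProbabilityMeasure κ] :
    DifferentiableOn ℂ (logFactor₂ α δ κ) disk := fun _ hz =>
  (hasDerivAt_logFactor₂ α δ κ hz).differentiableAt.differentiableWithinAt

theorem isStarlike_exp_logFactor {α : ℝ} (hα₀ : 0 ≤ α) (hα₁ : α < 1)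
    (δ κ : Measure (sphere (0 : ℂ) 1)) [IsProbabilityMeasure δ] [IsProbabilityMeasure κ]
    {f : ℂ → ℂ} (hf : ∀ z ∈ disk, f z = z * Complex.exp (logFactor₁ α δ κ z) *
      star (Complex.exp (logFactor₂ α δ κ z))) : IsStarlike α f := by
  have hT : ∀ z ∈ disk, cauchyTransform κ z ≠ 0 := fun z hz h => by
    have := half_lt_re_cauchyTransform κ hz
    norm_num [h] at this
  refine isStarlike_of_exp hα₀ (μ := fun z => 1 - (cauchyTransform κ z)⁻¹)
    (differentiableOn_logFactor₁ α δ κ) (differentiableOn_logFactor₂ α δ κ)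
    (logFactor₁_zero α δ κ) (logFactor₂_zero α δ κ)
    ⟨((differentiableOn_cauchyTransform κ).inv hT).const_sub 1, fun z hz => ?_⟩
    (by simp [cauchyTransform_zero]) (fun z hz => ?_) (fun z hz => ?_) hf
  · have h1 := half_lt_re_cauchyTransform κ hz
    have h2 := hT z hz
    change ‖1 - (cauchyTransform κ z)⁻¹‖ < 1
    set T := cauchyTransform κ z
    -- `‖T - 1‖ < ‖T‖` says that `T` is closer to `1` than to `0`, that is, `Re T > 1/2`.
    rw [show 1 - T⁻¹ = (T - 1) / T by field_simp, norm_div, div_lt_one (norm_pos_iff.2 h2)]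
    refine lt_of_pow_lt_pow_left₀ 2 (norm_nonneg _) ?_
    rw [← Complex.normSq_eq_norm_sq, ← Complex.normSq_eq_norm_sq, Complex.normSq_apply,
      Complex.normSq_apply]
    simp only [Complex.sub_re, Complex.sub_im, Complex.one_re, Complex.one_im]
    nlinarith
  · rw [mul_deriv_logFactor₁ α δ κ hz, mul_deriv_logFactor₂ α δ κ hz]
    have := hT z hz
    field_simp
    ring
  · rw [mul_deriv_logFactor₁ α δ κ hz, mul_deriv_logFactor₂ α δ κ hz]
    have h1 := half_lt_re_cauchyTransform δ hz
    set T := cauchyTransform δ z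
    rw [show 1 + (cauchyTransform κ z * (2 * (1 - α) * T - (1 - 2 * α)) - 1) -
      (cauchyTransform κ z - 1) * (2 * (1 - α) * T - (1 - 2 * α)) =
      ((2 * (1 - α) : ℝ) : ℂ) * T - ((1 - 2 * α : ℝ) : ℂ) by push_cast; ring]
    rw [Complex.sub_re, Complex.re_ofReal_mul, Complex.ofReal_re]
    nlinarith

theorem exists_measures_eqOn_logFactor {α : ℝ} (hα : α < 1) {S₁ S₂ μ : ℂ → ℂ}
    (hS₁ : DifferentiableOn ℂ S₁ disk) (hS₂ : DifferentiableOn ℂ S₂ disk)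
    (hS₁0 : S₁ 0 = 0) (hS₂0 : S₂ 0 = 0) (hμ : IsDilatation μ) (hμ0 : μ 0 = 0)
    (hB : ∀ z ∈ disk, z * deriv S₂ z = μ z * (1 + z * deriv S₁ z))
    (hP : ∀ z ∈ disk, α < (1 + z * deriv S₁ z - z * deriv S₂ z).re) :
    ∃ δ κ : Measure (sphere (0 : ℂ) 1), IsProbabilityMeasure δ ∧ IsProbabilityMeasure κ ∧
      Set.EqOn S₁ (logFactor₁ α δ κ) disk ∧ Set.EqOn S₂ (logFactor₂ α δ κ) disk := by
  have hα' : (1 - α : ℂ) ≠ 0 := by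
    exact_mod_cast (sub_pos.2 hα).ne'
  have hμ1 : ∀ z ∈ disk, 1 - μ z ≠ 0 := fun z hz h => by
    have := hμ.2 z hz
    rw [← sub_eq_zero.1 h] at this
    simp at this
  have hd₁ := hS₁.deriv isOpen_ball
  have hd₂ := hS₂.deriv isOpen_ball
  -- `(P - α) / (1 - α)` has positive real part and value `1` at the origin.
  obtain ⟨δ, hδ, hδ'⟩ := exists_cauchyTransform_eq
    (p := fun z => ((1 - α : ℝ)⁻¹ : ℝ) * (1 + z * deriv S₁ z - z * deriv S₂ z - (α : ℝ)))
    (by fun_prop) (fun z hz => by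
      rw [Complex.re_ofReal_mul, Complex.sub_re, Complex.ofReal_re]
      exact mul_pos (inv_pos.2 (sub_pos.2 hα)) (sub_pos.2 (hP z hz)))
    (by simp [hα'])
  -- This is `(1 + μ) / (1 - μ)`, the Cayley transform of the dilatation.
  obtain ⟨κ, hκ, hκ'⟩ := exists_cauchyTransform_eq (p := fun z => 2 * (1 - μ z)⁻¹ - 1)
    ((((hμ.1.const_sub 1).inv hμ1).const_mul 2).sub_const 1) (fun z hz => by
      have h1 := hμ.2 z hz
      have h2 := Complex.normSq_pos.2 (hμ1 z hz)
      have h3 : ‖μ z‖ ^ 2 < 1 := by nlinarith [norm_nonneg (μ z)]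
      have h4 : (2 * (1 - μ z)⁻¹ - 1).re = (1 - ‖μ z‖ ^ 2) / Complex.normSq (1 - μ z) := by
        rw [eq_div_iff h2.ne', Complex.sub_re, show (2 : ℂ) = ((2 : ℝ) : ℂ) by simp,
          Complex.re_ofReal_mul, Complex.inv_re, Complex.one_re, sub_mul, mul_assoc,
          div_mul_cancel₀ _ h2.ne', ← Complex.normSq_eq_norm_sq, Complex.normSq_apply,
          Complex.normSq_apply]
        simp only [Complex.sub_re, Complex.sub_im, Complex.one_re, Complex.one_im]
        ring
      rw [h4]
      exact div_pos (sub_pos.2 h3) h2) (by norm_num [hμ0])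
  have hT : ∀ z ∈ disk, 2 * (1 - α) * cauchyTransform δ z - (1 - 2 * α) =
      1 + z * deriv S₁ z - z * deriv S₂ z := fun z hz => by
    have h1 := hδ' z hz
    push_cast at h1
    field_simp at h1
    linear_combination -h1
  have hQ : ∀ z ∈ disk, cauchyTransform κ z = (1 - μ z)⁻¹ := fun z hz => by
    linear_combination (-1 / 2 : ℂ) * hκ' z hz
  refine ⟨δ, κ, hδ, hκ, eqOn_disk_of_mul_deriv_eq hS₁ (differentiableOn_logFactor₁ α δ κ)
    (hS₁0.trans (logFactor₁_zero α δ κ).symm) fun z hz => ?_,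
    eqOn_disk_of_mul_deriv_eq hS₂ (differentiableOn_logFactor₂ α δ κ)
    (hS₂0.trans (logFactor₂_zero α δ κ).symm) fun z hz => ?_⟩
  · rw [mul_deriv_logFactor₁ α δ κ hz, hT z hz, hQ z hz, hB z hz]
    have := hμ1 z hz
    field_simp
    ring
  · rw [mul_deriv_logFactor₂ α δ κ hz, hT z hz, hQ z hz, hB z hz]
    have := hμ1 z hz
    field_simp
    ring

end LogHarmonic


theorem mainTheorem1 (α : ℝ) (hα₀ : 0 ≤ α) (hα₁ : α < 1) (f h g : ℂ → ℂ)
    (hf : ∀ z ∈ LogHarmonic.disk, f z = z * h z * star (g z)) :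
    (LogHarmonic.IsStarlike α f ∧ LogHarmonic.IsFactor h ∧ LogHarmonic.IsFactor g) ↔
      ∃ δ κ : Measure (Metric.sphere (0 : ℂ) 1), IsProbabilityMeasure δ ∧ IsProbabilityMeasure κ ∧
        (∀ z ∈ LogHarmonic.disk,
          h z = Complex.exp (∫ ξ, ∫ η, LogHarmonic.K₁ α z η ξ ∂δ ∂κ)) ∧
        (∀ z ∈ LogHarmonic.disk,
          g z = Complex.exp (∫ ξ, ∫ η, LogHarmonic.K₂ α z η ξ ∂δ ∂κ)) := by
  open LogHarmonic in
  constructor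
  · rintro ⟨hst, hh, hg⟩
    obtain ⟨S₁, hS₁, hS₁0, hh⟩ := isFactor_iff.1 hh
    obtain ⟨S₂, hS₂, hS₂0, hg⟩ := isFactor_iff.1 hg
    obtain ⟨⟨μ, hμ, hμ0, hB⟩, hP⟩ := exists_dilatation_of_isStarlike hα₁ hS₁ hS₂
      (fun z hz => by rw [hf z hz, hh z hz, hg z hz]) hst
    obtain ⟨δ, κ, hδ, hκ, h₁, h₂⟩ :=
      exists_measures_eqOn_logFactor hα₁ hS₁ hS₂ hS₁0 hS₂0 hμ hμ0 hB hP
    exact ⟨δ, κ, hδ, hκ, fun z hz => (hh z hz).trans (congrArg _ (h₁ hz)),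
      fun z hz => (hg z hz).trans (congrArg _ (h₂ hz))⟩
  · rintro ⟨δ, κ, hδ, hκ, hh, hg⟩
    exact ⟨isStarlike_exp_logFactor hα₀ hα₁ δ κ fun z hz => by
        rw [hf z hz, hh z hz, hg z hz, logFactor₁, logFactor₂],
      isFactor_iff.2 ⟨_, differentiableOn_logFactor₁ α δ κ, logFactor₁_zero α δ κ, hh⟩,
      isFactor_iff.2 ⟨_, differentiableOn_logFactor₂ α δ κ, logFactor₂_zero α δ κ, hg⟩⟩
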